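/- Throughout, subgroups of topological groups are taken to be closed. For a prime $p$, a pro-$p$ group is a profinite group in which every open normal subgroup has index a power of $p$. The Frattini subgroup $\Phi(G)$ of a pro-$p$ group $G$ is the intersection of all maximal (proper closed) subgroups of $G$. A pro-$p$ group $G$ is called strongly Frattini-resistant if for all subgroups $H$ and $K$ of $G$, \[ H \leq K \iff \Phi(H) \leq \Phi(K). \] Theorem. Let $k$ be a field, let $k_s$ be a separable closure of $k$, and let $G_k = \mathrm{Gal}(k_s/k)$ be the absolute Galois group of $k$, equipped with the Krull topology. Then, for every odd prime $p$, every pro-$p$ subgroup of $G_k$ is strongly Frattini-resistant. Moreover, if $\sqrt{-1} \in k$ (that is, if $-1$ is a square in $k$), then every pro-$2$ subgroup of $G_k$ is also strongly Frattini-resistant. -/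

import Mathlib

/-- A topological group `G` is a pro-`p` group: it is profinite (compact, Hausdorff and totally
disconnected) and every open normal subgroup has index a power of `p`. -/
structure IsProP (p : ℕ) (G : Type*) [Group G] [TopologicalSpace G] : Prop where
  isTopologicalGroup : IsTopologicalGroup G
  compactSpace : CompactSpace G
  t2Space : T2Space G
  totallyDisconnectedSpace : TotallyDisconnectedSpace G
  index_eq_pow : ∀ U : Subgroup G, U.Normal → IsOpen (U : Set G) → ∃ n : ℕ, U.index = p ^ n

/-- `M` is a maximal (closed) subgroup of the topological group `G`: it is maximal among the proper
closed subgroups of `G`. -/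
def IsMaximalClosedSubgroup {G : Type*} [Group G] [TopologicalSpace G] (M : Subgroup G) : Prop :=
  Maximal (fun N : Subgroup G => IsClosed (N : Set G) ∧ N ≠ ⊤) M

/-- The Frattini subgroup of a topological group `G`: the intersection of all maximal closed
subgroups of `G` (and `G` itself if there are none). -/
def topFrattini (G : Type*) [Group G] [TopologicalSpace G] : Subgroup G :=
  sInf {M : Subgroup G | IsMaximalClosedSubgroup M}

/-- The Frattini subgroup `Φ(H)` of a subgroup `H` of `G` (with the subspace topology), regarded as
a subgroup of `G`. -/
def Subgroup.topFrattini {G : Type*} [Group G] [TopologicalSpace G] (H : Subgroup G) :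
    Subgroup G :=
  (_root_.topFrattini H).map H.subtype

/-- `G` is strongly Frattini-resistant: for all closed subgroups `H` and `K` of `G`, one has
`H ≤ K` if and only if `Φ(H) ≤ Φ(K)`. -/
def StronglyFrattiniResistant (G : Type*) [Group G] [TopologicalSpace G] : Prop :=
  ∀ H K : Subgroup G, IsClosed (H : Set G) → IsClosed (K : Set G) →
    (H ≤ K ↔ H.topFrattini ≤ K.topFrattini)

/-! Monotonicity of `Φ` is general pro-`p` theory. For the converse, `x ∈ H` gives `x ^ p ∈ Φ(H) ≤
Φ(K)`, so it suffices that `x ^ p ∈ Φ(K)` forces `x ∈ K`. If `x ∉ K`, some closed `M ≥ K` is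
normalized by `x` and contains `x ^ p` but not `x`. On the fixed field `N` of `M`, `σ = x` acts with
order `p`. Kummer theory, or Artin–Schreier theory in characteristic `p`, gives `c ∈ N` and a root
`b` of `X ^ p - c`, respectively `X ^ p - X - c`, with `σ ^ p b ≠ b`. But `K` fixes `c`, so the
`K`-orbit of `b` has 1 or `p` elements and `Φ(K)` fixes `b`: a contradiction. -/

/-! ### Pro-`p` groups and their Frattini subgroups -/

theorem IsProP.exists_index_eq_pow {p : ℕ} (hp : p.Prime) {G : Type*} [Group G]
    [TopologicalSpace G] (hG : IsProP p G) (U : Subgroup G) (hU : IsOpen (U : Set G)) :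
    ∃ n : ℕ, U.index = p ^ n := by
  have := hG.isTopologicalGroup
  have := hG.compactSpace
  have : Finite (G ⧸ U) := U.quotient_finite_of_isOpen hU
  have : U.FiniteIndex := Subgroup.finiteIndex_of_finite_quotient
  have hUc : IsClosed (U : Set G) := (⟨U, hU⟩ : OpenSubgroup G).isClosed
  obtain ⟨n, hn⟩ := hG.index_eq_pow U.normalCore inferInstance
    (Subgroup.isOpen_of_isClosed_of_finiteIndex _ (U.normalCore_isClosed hUc))
  obtain ⟨m, -, hm⟩ := (Nat.dvd_prime_pow hp).1 (hn ▸ Subgroup.index_dvd_of_le U.normalCore_le)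
  exact ⟨m, hm⟩

theorem IsProP.of_isClosed {p : ℕ} (hp : p.Prime) {G : Type*} [Group G]
    [TopologicalSpace G] (hG : IsProP p G) (H : Subgroup G) (hH : IsClosed (H : Set G)) :
    IsProP p H := by
  have := hG.isTopologicalGroup
  have := hG.compactSpace
  have := hG.t2Space
  have := hG.totallyDisconnectedSpace
  refine ⟨inferInstance, isCompact_iff_compactSpace.1 hH.isCompact, inferInstance, inferInstance,
    fun U _ hU => ?_⟩
  obtain ⟨W, hW, hWU⟩ := isOpen_induced_iff.1 hU
  obtain ⟨V, hV⟩ := ProfiniteGrp.exist_openNormalSubgroup_sub_open_nhds_of_one hW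
    (by have : (1 : H) ∈ (Subtype.val ⁻¹' W : Set H) := hWU ▸ U.one_mem
        exact this)
  obtain ⟨n, hn⟩ := hG.index_eq_pow V.toSubgroup inferInstance V.isOpen
  have hle : V.toSubgroup.subgroupOf H ≤ U := fun h hh => by
    have : h ∈ (Subtype.val ⁻¹' W : Set H) := hV hh
    rwa [hWU] at this
  have h2 : U.index ∣ p ^ n := (Subgroup.index_dvd_of_le hle).trans
    (hn ▸ Subgroup.relIndex_dvd_index_of_normal V.toSubgroup H)
  obtain ⟨m, -, hm⟩ := (Nat.dvd_prime_pow hp).1 h2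
  exact ⟨m, hm⟩

/-- An open normal subgroup separates a point from `K`, which reduces the claim to proper subgroups
of a finite `p`-group. -/
theorem IsProP.exists_normal_index_eq {p : ℕ} (hp : p.Prime) {G : Type*} [Group G]
    [TopologicalSpace G] (hG : IsProP p G) (K : Subgroup G) (hK : IsClosed (K : Set G))
    (hK' : K ≠ ⊤) :
    ∃ M : Subgroup G, M.Normal ∧ IsOpen (M : Set G) ∧ M.index = p ∧ K ≤ M := by
  have := hG.isTopologicalGroup
  have := hG.compactSpace
  have := hG.t2Space
  have := hG.totallyDisconnectedSpace
  have : Fact p.Prime := ⟨hp⟩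
  obtain ⟨x, hx⟩ : ∃ x, x ∉ K := by
    by_contra! h
    exact hK' ((Subgroup.eq_top_iff' K).2 h)
  have hW : IsOpen ((fun v => x * v) ⁻¹' (K : Set G)ᶜ) :=
    hK.isOpen_compl.preimage (continuous_const_mul x)
  obtain ⟨V, hV⟩ := ProfiniteGrp.exist_openNormalSubgroup_sub_open_nhds_of_one hW (by simpa using hx)
  obtain ⟨n, hn⟩ := hG.index_eq_pow V.toSubgroup inferInstance V.isOpen
  have : Finite (G ⧸ V.toSubgroup) := Nat.finite_of_card_ne_zero (by
    rw [← Subgroup.index, hn]; exact pow_ne_zero _ hp.ne_zero)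
  have hcard : Nat.card (G ⧸ V.toSubgroup) = p ^ n := hn
  set π := QuotientGroup.mk' V.toSubgroup with hπ
  have hπs : Function.Surjective π := QuotientGroup.mk'_surjective _
  have hne : K.map π ≠ ⊤ := fun h => by
    have : π x ∈ K.map π := h ▸ Subgroup.mem_top _
    obtain ⟨y, hy, hxy⟩ := this
    have h1 : x⁻¹ * y ∈ V.toSubgroup := QuotientGroup.eq.1 hxy.symm
    have := hV h1
    simp at this
    exact this hy
  obtain ⟨m, hmn, hm⟩ := (Nat.dvd_prime_pow hp).1 (hcard ▸ (K.map π).card_subgroup_dvd_card)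
  have hlt : m < n := lt_of_le_of_ne hmn fun h => hne ((K.map π).eq_top_of_card_eq (by
    rw [hm, hcard, h]))
  obtain ⟨L, hL, hKL⟩ := Sylow.exists_subgroup_card_pow_prime_le p (n := m) (m := n - 1)
    (hcard ▸ pow_dvd_pow p (Nat.sub_le n 1)) (K.map π) hm (by omega)
  have hLi : L.index = p := by
    have h := L.card_mul_index
    rw [hL, hcard] at h
    refine Nat.eq_of_mul_eq_mul_left (pow_pos hp.pos (n - 1)) (h.trans ?_)
    rw [← pow_succ, Nat.sub_add_cancel (by omega)]
  have hLn : L.Normal := Subgroup.normal_of_index_eq_minFac_card (by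
    rw [hLi, hcard, hp.pow_minFac (by omega)])
  refine ⟨L.comap π, inferInstance, ?_, ?_, Subgroup.map_le_iff_le_comap.1 hKL⟩
  · refine Subgroup.isOpen_mono (H₁ := V.toSubgroup) (fun v hv => ?_) V.isOpen
    have : π v = 1 := (QuotientGroup.eq_one_iff v).2 hv
    rw [Subgroup.mem_comap, this]
    exact L.one_mem
  · rw [Subgroup.index_comap_of_surjective _ hπs, hLi]

theorem isMaximalClosedSubgroup_of_index_prime {p : ℕ} (hp : p.Prime) {G : Type*} [Group G]
    [TopologicalSpace G] {M : Subgroup G} (hM : IsClosed (M : Set G)) (hi : M.index = p) :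
    IsMaximalClosedSubgroup M := by
  refine ⟨⟨hM, fun h => hp.one_lt.ne' (by rw [← hi, h, Subgroup.index_top])⟩, fun N hN hMN => ?_⟩
  have h := Subgroup.relIndex_mul_index hMN
  rw [hi] at h
  rcases (Nat.dvd_prime hp).1 (Dvd.intro_left _ h) with h1 | h1
  · exact absurd (Subgroup.index_eq_one.1 h1) hN.2
  · rw [h1] at h
    exact Subgroup.relIndex_eq_one.1 (Nat.eq_of_mul_eq_mul_right hp.pos (by rw [h, one_mul]))

theorem topFrattini_le_of_index_dvd {p : ℕ} (hp : p.Prime) {G : Type*} [Group G]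
    [TopologicalSpace G] {M : Subgroup G} (hM : IsClosed (M : Set G)) (hi : M.index ∣ p) :
    topFrattini G ≤ M := by
  rcases (Nat.dvd_prime hp).1 hi with h | h
  · rw [Subgroup.index_eq_one.1 h]
    exact le_top
  · exact sInf_le (isMaximalClosedSubgroup_of_index_prime hp hM h)

theorem IsProP.normal_and_index_eq_of_isMaximalClosedSubgroup {p : ℕ} (hp : p.Prime) {G : Type*}
    [Group G] [TopologicalSpace G] (hG : IsProP p G) {M : Subgroup G}
    (hM : IsMaximalClosedSubgroup M) : M.Normal ∧ M.index = p := by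
  have := hG.isTopologicalGroup
  obtain ⟨N, hN, hNo, hNi, hMN⟩ := hG.exists_normal_index_eq hp M hM.prop.1 hM.prop.2
  have hNc : IsClosed (N : Set G) := (⟨N, hNo⟩ : OpenSubgroup G).isClosed
  have := hM.eq_of_le (isMaximalClosedSubgroup_of_index_prime hp hNc hNi).prop hMN
  subst this
  exact ⟨hN, hNi⟩

theorem IsProP.pow_mem_topFrattini {p : ℕ} (hp : p.Prime) {G : Type*}
    [Group G] [TopologicalSpace G] (hG : IsProP p G) (x : G) : x ^ p ∈ topFrattini G := by
  refine Subgroup.mem_sInf.2 fun M hM => ?_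
  obtain ⟨hn, hi⟩ := hG.normal_and_index_eq_of_isMaximalClosedSubgroup hp hM
  exact hi ▸ M.pow_index_mem x

/-- A maximal closed subgroup of `K` is normal of index `p`, so its trace on `H` has index 1 or `p`.
-/
theorem IsProP.topFrattini_mono {p : ℕ} (hp : p.Prime) {G : Type*}
    [Group G] [TopologicalSpace G] (hG : IsProP p G) {H K : Subgroup G}
    (hK : IsClosed (K : Set G)) (h : H ≤ K) : H.topFrattini ≤ K.topFrattini := by
  rintro _ ⟨y, hy, rfl⟩
  refine ⟨Subgroup.inclusion h y, Subgroup.mem_sInf.2 fun M hM => ?_, rfl⟩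
  replace hM : IsMaximalClosedSubgroup M := hM
  obtain ⟨hn, hi⟩ := (hG.of_isClosed hp K hK).normal_and_index_eq_of_isMaximalClosedSubgroup hp hM
  refine topFrattini_le_of_index_dvd hp (M := M.comap (Subgroup.inclusion h))
    (hM.prop.1.preimage (continuous_inclusion h)) ?_ hy
  rw [Subgroup.index_comap, ← hi]
  exact Subgroup.relIndex_dvd_index_of_normal M _

open Polynomial in
theorem IsProP.index_stabilizer_eq_pow_le {p : ℕ} (hp : p.Prime) {G : Type*} [Group G]
    [TopologicalSpace G] (hG : IsProP p G) {F : Type*} [Field F] [MulAction G F] {a : F}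
    (ho : IsOpen (MulAction.stabilizer G a : Set G)) {q : F[X]} (hq : q ≠ 0)
    (hroot : ∀ g : G, q.IsRoot (g • a)) :
    ∃ n : ℕ, (MulAction.stabilizer G a).index = p ^ n ∧ p ^ n ≤ q.natDegree := by
  classical
  obtain ⟨n, hn⟩ := hG.exists_index_eq_pow hp _ ho
  refine ⟨n, hn, ?_⟩
  rw [← hn, MulAction.index_stabilizer]
  have hsub : MulAction.orbit G a ⊆ (q.roots.toFinset : Set F) := by
    rintro _ ⟨g, rfl⟩
    simpa [hq] using hroot g
  calc (MulAction.orbit G a).ncard ≤ (q.roots.toFinset : Set F).ncard :=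
        Set.ncard_le_ncard hsub (Finset.finite_toSet _)
    _ = q.roots.toFinset.card := Set.ncard_coe_finset _
    _ ≤ q.roots.card := Multiset.toFinset_card_le _
    _ ≤ q.natDegree := q.card_roots'

theorem IsProP.exists_isClosed_pow_mem_notMem {p : ℕ} (hp : p.Prime) {G : Type*} [Group G]
    [TopologicalSpace G] (hG : IsProP p G) {K : Subgroup G} (hK : IsClosed (K : Set G)) {x : G}
    (hx : x ∉ K) :
    ∃ M : Subgroup G, IsClosed (M : Set G) ∧ K ≤ M ∧ x ∉ M ∧ x ^ p ∈ M ∧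
      ∀ m ∈ M, x⁻¹ * m * x ∈ M := by
  have := hG.isTopologicalGroup
  have := hG.compactSpace
  have := hG.t2Space
  -- Since `K` and `x` generate `L` topologically, no proper closed subgroup of `L` containing `K`
  -- contains `x`.
  set L := (K ⊔ Subgroup.zpowers x).topologicalClosure with hL
  have hLc : IsClosed (L : Set G) := Subgroup.isClosed_topologicalClosure _
  have hle : K ⊔ Subgroup.zpowers x ≤ L := Subgroup.le_topologicalClosure _
  have hKL : K ≤ L := le_sup_left.trans hle
  have hxL : x ∈ L := hle (Subgroup.mem_sup_right (Subgroup.mem_zpowers x))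
  obtain ⟨M, hMn, hMo, hMi, hKM⟩ := (hG.of_isClosed hp L hLc).exists_normal_index_eq hp
    (K.subgroupOf L) (hK.preimage continuous_subtype_val) fun h => by
      have : (⟨x, hxL⟩ : L) ∈ K.subgroupOf L := h ▸ Subgroup.mem_top _
      exact hx this
  have hMc : IsClosed (M : Set L) := (⟨M, hMo⟩ : OpenSubgroup L).isClosed
  have hMc' : IsClosed ((M.map L.subtype : Subgroup G) : Set G) :=
    hLc.isClosedEmbedding_subtypeVal.isClosedMap _ hMc
  have hKM' : K ≤ M.map L.subtype := fun y hy =>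
    ⟨⟨y, hKL hy⟩, hKM (show y ∈ K from hy), rfl⟩
  refine ⟨M.map L.subtype, hMc', hKM', fun hxM => ?_, ?_, ?_⟩
  · have h1 : L ≤ M.map L.subtype := Subgroup.topologicalClosure_minimal _
      (sup_le hKM' ((Subgroup.zpowers_le).2 hxM)) hMc'
    have h2 : M = ⊤ := (Subgroup.eq_top_iff' M).2 fun y => by
      obtain ⟨z, hz, hzy⟩ := h1 y.2
      rwa [← Subtype.ext hzy]
    rw [h2, Subgroup.index_top] at hMi
    exact hp.one_lt.ne hMi
  · exact ⟨⟨x, hxL⟩ ^ p, hMi ▸ M.pow_index_mem _, rfl⟩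
  · rintro _ ⟨m, hm, rfl⟩
    refine ⟨⟨x, hxL⟩⁻¹ * m * ⟨x, hxL⟩, ?_, rfl⟩
    simpa using hMn.conj_mem m hm ⟨x, hxL⟩⁻¹

/-! ### Kummer and Artin–Schreier constructions for one automorphism -/

section FieldAction

variable {G F : Type*} [Group G] [Field F] [MulSemiringAction G F]

/-- Dedekind independence of characters: as `p` is prime, the powers `σ ^ i`, `i < p`, are distinct
on `N`. -/
theorem exists_sum_smul_ne_zero {p : ℕ} (hp : p.Prime) (σ : G) (N : Subfield F)
    (hσp : ∀ a ∈ N, σ ^ p • a = a) (hσ : ∃ a ∈ N, σ • a ≠ a) (c : ℕ → F) (hc : c 0 ≠ 0) :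
    ∃ a ∈ N, ∑ i ∈ Finset.range p, c i * σ ^ i • a ≠ 0 := by
  let f : Fin p → (N →* F) := fun i =>
    ((MulSemiringAction.toRingHom G F (σ ^ (i : ℕ))).comp N.subtype : N →+* F)
  have key : ∀ i j : ℕ, i < j → j < p → ∃ a ∈ N, σ ^ i • a ≠ σ ^ j • a := by
    intro i j hij hj
    by_contra! h
    obtain ⟨a, ha, hne⟩ := hσ
    apply hne
    have h1 : σ ^ (j - i) ∈ MulAction.stabilizer G a := by
      rw [MulAction.mem_stabilizer_iff]
      apply smul_left_cancel (σ ^ i)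
      rw [smul_smul, ← pow_add, Nat.add_sub_cancel' hij.le, h a ha]
    have h2 : σ ^ p ∈ MulAction.stabilizer G a := hσp a ha
    have hco : Nat.gcd (j - i) p = 1 :=
      (Nat.coprime_of_lt_prime (by omega) (by omega : j - i < p) hp).symm
    have h3 : σ ∈ MulAction.stabilizer G a := by
      have hb := Nat.gcd_eq_gcd_ab (j - i) p
      rw [hco] at hb
      have : σ = (σ ^ (j - i)) ^ (Nat.gcdA (j - i) p) * (σ ^ p) ^ (Nat.gcdB (j - i) p) := by
        rw [← zpow_natCast, ← zpow_natCast, ← zpow_mul, ← zpow_mul, ← zpow_add, ← hb]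
        simp
      rw [this]
      exact mul_mem (zpow_mem h1 _) (zpow_mem h2 _)
    exact h3
  have hf : Function.Injective f := by
    intro i j hij
    have hval : ∀ a ∈ N, σ ^ (i : ℕ) • a = σ ^ (j : ℕ) • a := fun a ha =>
      DFunLike.congr_fun hij ⟨a, ha⟩
    rcases lt_trichotomy (i : ℕ) j with h | h | h
    · obtain ⟨a, ha, hne⟩ := key i j h j.2
      exact absurd (hval a ha) hne
    · exact Fin.ext h
    · obtain ⟨a, ha, hne⟩ := key j i h i.2
      exact absurd (hval a ha).symm hne
  have hli := (linearIndependent_monoidHom N F).comp f hf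
  rw [Fintype.linearIndependent_iff] at hli
  by_contra! h
  refine hc (hli (fun i => c i) (funext fun a => ?_) ⟨0, hp.pos⟩)
  rw [Finset.sum_apply, Pi.zero_apply, ← h a a.2, Finset.sum_range]
  rfl

theorem mul_smul_sum_eq {p : ℕ} {σ : G} {ω a : F} (hω : ω ^ p = 1) (hσω : σ • ω = ω)
    (ha : σ ^ p • a = a) :
    ω * σ • ∑ i ∈ Finset.range p, ω ^ i * σ ^ i • a = ∑ i ∈ Finset.range p, ω ^ i * σ ^ i • a := by
  have h : ω * σ • ∑ i ∈ Finset.range p, ω ^ i * σ ^ i • a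
      = ∑ i ∈ Finset.range p, ω ^ (i + 1) * σ ^ (i + 1) • a := by
    rw [Finset.smul_sum, Finset.mul_sum]
    refine Finset.sum_congr rfl fun i _ => ?_
    rw [smul_mul', smul_pow', hσω, smul_smul, ← pow_succ', ← mul_assoc, ← pow_succ']
  have h1 := Finset.sum_range_succ' (fun i => ω ^ i * σ ^ i • a) p
  rw [Finset.sum_range_succ, hω, ha] at h1
  rw [h]
  simpa using h1.symm

theorem pow_smul_mem {σ : G} {N : Subfield F} (hσN : ∀ a ∈ N, σ • a ∈ N) (i : ℕ) {a : F}
    (ha : a ∈ N) : σ ^ i • a ∈ N := by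
  induction i with
  | zero => simpa
  | succ i ih =>
    rw [pow_succ', mul_smul]
    exact hσN _ ih

theorem pow_smul_eq_of_smul_eq {σ : G} {b ξ ζ : F} (hb : σ • b = ξ * b) (hξ : σ • ξ = ξ * ζ)
    (hζ : σ • ζ = ζ) (n : ℕ) : σ ^ n • b = ξ ^ n * ζ ^ n.choose 2 * b := by
  induction n with
  | zero => simp
  | succ n ih =>
    rw [pow_succ', mul_smul, ih, smul_mul', smul_mul', smul_pow', smul_pow', hb, hξ, hζ,
      Nat.choose_succ_succ' n 1, Nat.choose_one_right]
    ring

theorem exists_root_pow_smul_ne_of_isPrimitiveRoot [IsSepClosed F] {p : ℕ} (hp : p.Prime)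
    (hpF : (p : F) ≠ 0) {σ : G} {N : Subfield F}
    (hσp : ∀ a ∈ N, σ ^ p • a = a) (hσN : ∀ a ∈ N, σ • a ∈ N) (hσ : ∃ a ∈ N, σ • a ≠ a)
    {ζ : F} (hζ : IsPrimitiveRoot ζ p) (hζN : ζ ∈ N) (hσζ : σ • ζ = ζ)
    (h2 : p = 2 → ∃ i : F, i ^ 2 = -1 ∧ σ • i = i) :
    ∃ b c : F, c ∈ N ∧ b ^ p = c ∧ σ ^ p • b ≠ b := by
  have hpow : ∀ i : ℕ, ∀ a ∈ N, σ ^ i • a ∈ N := fun i _ ha => pow_smul_mem hσN i ha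
  have hζ0 : ζ ≠ 0 := hζ.ne_zero hp.ne_zero
  obtain ⟨a, ha, hne⟩ := exists_sum_smul_ne_zero hp σ N hσp hσ (fun i => ζ⁻¹ ^ i) (by simp)
  set c := ∑ i ∈ Finset.range p, ζ⁻¹ ^ i * σ ^ i • a with hc
  have hσc : σ • c = ζ * c := by
    have := mul_smul_sum_eq (σ := σ) (ω := ζ⁻¹) (a := a) (p := p)
      (by rw [inv_pow, hζ.pow_eq_one, inv_one]) (by rw [smul_inv'', hσζ]) (hσp a ha)
    rw [← hc] at this
    nth_rewrite 2 [← this]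
    rw [mul_inv_cancel_left₀ hζ0]
  have hcN : c ∈ N := sum_mem fun i _ => mul_mem (pow_mem (inv_mem hζN) _) (hpow i a ha)
  have : NeZero (p : F) := ⟨hpF⟩
  obtain ⟨b, hb⟩ := IsSepClosed.exists_pow_nat_eq c p
  refine ⟨b, c, hcN, hb, ?_⟩
  have hb0 : b ≠ 0 := by
    rintro rfl
    rw [zero_pow hp.ne_zero] at hb
    exact hne hb.symm
  set ξ := σ • b / b with hξ
  have hσb : σ • b = ξ * b := by rw [hξ, div_mul_cancel₀ _ hb0]
  have hξp : ξ ^ p = ζ := by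
    rw [hξ, div_pow, ← smul_pow', hb, hσc, mul_div_cancel_right₀ _ hne]
  have hξ0 : ξ ≠ 0 := by
    rintro h
    rw [h, zero_pow hp.ne_zero] at hξp
    exact hζ0 hξp.symm
  -- This kills the factor `ζ ^ (t * p.choose 2)` in `σ ^ p • b`, leaving `ζ * b`. For odd `p`, `p`
  -- divides `p.choose 2`; for `p = 2`, `ξ` is a fixed square root of `-1`, so `t = 0`.
  obtain ⟨t, ht, hdvd⟩ : ∃ t : ℕ, σ • ξ = ξ * ζ ^ t ∧ p ∣ t * p.choose 2 := by
    rcases hp.eq_two_or_odd' with rfl | hodd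
    · obtain ⟨i, hi, hσi⟩ := h2 rfl
      have hζ1 : ζ = -1 := by
        have h1 := hζ.pow_eq_one
        rcases sq_eq_sq_iff_eq_or_eq_neg.1 (h1.trans (one_pow 2).symm) with h | h
        · exact absurd h (hζ.ne_one one_lt_two)
        · exact h
      refine ⟨0, ?_, by simp⟩
      rw [hζ1, ← hi] at hξp
      rcases sq_eq_sq_iff_eq_or_eq_neg.1 hξp with h | h <;> simp [h, hσi]
    · have : NeZero p := ⟨hp.ne_zero⟩
      obtain ⟨t, -, ht⟩ := hζ.eq_pow_of_pow_eq_one (ξ := σ • ξ / ξ) (by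
        rw [div_pow, ← smul_pow', hξp, hσζ, div_self hζ0])
      have h3 : 2 < p := lt_of_le_of_ne hp.two_le (fun h => by
        rw [← h] at hodd
        exact absurd hodd (by decide))
      exact ⟨t, by rw [ht, mul_div_cancel₀ _ hξ0],
        (hp.dvd_choose_self two_ne_zero h3).mul_left t⟩
  have h1 := pow_smul_eq_of_smul_eq hσb ht (by rw [smul_pow', hσζ]) p
  obtain ⟨s, hs⟩ := hdvd
  rw [hξp, ← pow_mul, hs, pow_mul, hζ.pow_eq_one, one_pow, mul_one] at h1
  rw [h1]
  intro h
  exact hζ.ne_one hp.one_lt (mul_right_cancel₀ hb0 (h.trans (one_mul b).symm))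

theorem sum_pow_smul_smul {p : ℕ} {σ : G} {a : F} (ha : σ ^ p • a = a) :
    ∑ i ∈ Finset.range p, σ ^ (i + 1) • a = ∑ i ∈ Finset.range p, σ ^ i • a := by
  have h1 := Finset.sum_range_succ' (fun i => σ ^ i • a) p
  rw [Finset.sum_range_succ, ha] at h1
  simpa using h1.symm

/-- Additive Hilbert 90: partial traces of `u`, weighted by the conjugates of the trace-one element
`Q`. -/
theorem exists_smul_sub_eq_of_sum_eq_zero {p : ℕ} {σ : G} {N : Subfield F}
    (hσN : ∀ i : ℕ, ∀ a ∈ N, σ ^ i • a ∈ N) {Q u : F} (hQ : Q ∈ N) (hu : u ∈ N)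
    (hσQ : σ ^ p • Q = Q) (hQ1 : ∑ i ∈ Finset.range p, σ ^ i • Q = 1)
    (hu0 : ∑ i ∈ Finset.range p, σ ^ i • u = 0) : ∃ r ∈ N, σ • r - r = u := by
  let S : ℕ → F := fun j => ∑ i ∈ Finset.range j, σ ^ i • u
  have hS : ∀ j, σ • S j = S (j + 1) - u := fun j => by
    simp only [S]
    rw [Finset.sum_range_succ', Finset.smul_sum, pow_zero, one_smul, add_sub_cancel_right]
    exact Finset.sum_congr rfl fun i _ => by rw [smul_smul, pow_succ']
  refine ⟨-∑ j ∈ Finset.range p, S j * σ ^ j • Q, neg_mem (sum_mem fun j _ =>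
    mul_mem (sum_mem fun i _ => hσN i u hu) (hσN j Q hQ)), ?_⟩
  have h1 : σ • ∑ j ∈ Finset.range p, S j * σ ^ j • Q
      = ∑ j ∈ Finset.range p, S (j + 1) * σ ^ (j + 1) • Q - u := by
    have hu1 : u * ∑ j ∈ Finset.range p, σ ^ (j + 1) • Q = u := by
      rw [sum_pow_smul_smul hσQ, hQ1, mul_one]
    refine Eq.trans ?_ (congrArg _ hu1)
    rw [Finset.smul_sum, Finset.mul_sum, ← Finset.sum_sub_distrib]
    refine Finset.sum_congr rfl fun j _ => ?_
    rw [smul_mul', hS, smul_smul, ← pow_succ', sub_mul]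
  have h2 := Finset.sum_range_succ' (fun j => S j * σ ^ j • Q) p
  have hSp : S p = 0 := hu0
  have hS0 : S 0 = 0 := Finset.sum_range_zero _
  rw [Finset.sum_range_succ, hSp, hS0] at h2
  simp only [zero_mul, add_zero] at h2
  rw [smul_neg, h1, ← h2]
  ring

theorem exists_root_pow_smul_ne_of_charP [IsSepClosed F] {p : ℕ} (hp : p.Prime)
    [CharP F p] {σ : G} {N : Subfield F}
    (hσp : ∀ a ∈ N, σ ^ p • a = a) (hσN : ∀ a ∈ N, σ • a ∈ N) (hσ : ∃ a ∈ N, σ • a ≠ a) :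
    ∃ b c : F, c ∈ N ∧ b ^ p - b = c ∧ σ ^ p • b ≠ b := by
  have : Fact p.Prime := ⟨hp⟩
  have hpow : ∀ i : ℕ, ∀ a ∈ N, σ ^ i • a ∈ N := fun i _ ha => pow_smul_mem hσN i ha
  obtain ⟨a, ha, hne⟩ := exists_sum_smul_ne_zero hp σ N hσp hσ (fun i => 1) one_ne_zero
  simp only [one_mul] at hne
  set t := ∑ i ∈ Finset.range p, σ ^ i • a with ht
  have htN : t ∈ N := sum_mem fun i _ => hpow i a ha
  have hσt : σ • t = t := by
    rw [ht, Finset.smul_sum]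
    simp_rw [smul_smul, ← pow_succ']
    exact sum_pow_smul_smul (hσp a ha)
  have hσt' : ∀ i : ℕ, σ ^ i • t = t := fun i =>
    (pow_mem (show σ ∈ MulAction.stabilizer G t from hσt) i : _)
  set Q := a / t with hQ
  have hQN : Q ∈ N := div_mem ha htN
  have hQ1 : ∑ i ∈ Finset.range p, σ ^ i • Q = 1 := by
    simp_rw [hQ, div_eq_mul_inv, smul_mul', smul_inv'', hσt']
    rw [← Finset.sum_mul, ← ht, mul_inv_cancel₀ hne]
  have huN : Q ^ p - Q ∈ N := sub_mem (pow_mem hQN p) hQN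
  obtain ⟨r, hr, hσr⟩ := exists_smul_sub_eq_of_sum_eq_zero hpow hQN huN (hσp Q hQN) hQ1 (by
    simp_rw [smul_sub, smul_pow']
    rw [Finset.sum_sub_distrib, ← sum_pow_char, hQ1, one_pow, sub_self])
  obtain ⟨b, hb⟩ := IsSepClosed.exists_root_C_mul_X_pow_add_C_mul_X_add_C' p p (1 : F) (-1) (-r)
    dvd_rfl hp.two_le (by simp)
  have hb : b ^ p - b = r := by linear_combination hb
  refine ⟨b, r, hr, hb, fun hfix => ?_⟩
  -- `e` lies in the prime field, so its trace is `p * e = 0`. If `σ ^ p` fixed `b`, the trace of `σ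
  -- • b - b` would telescope to 0, contradicting that `Q` has trace 1.
  set e := σ • b - b - Q with he
  have hep : e ^ p = e := by
    rw [he, sub_pow_char, sub_pow_char, ← smul_pow', show b ^ p = b + r by rw [← hb]; ring,
      smul_add, show Q ^ p = Q + (σ • r - r) by rw [hσr]; ring]
    ring
  have hσe : σ • e = e := by
    have h1 : e ∈ (⊥ : Subfield F) := (Subfield.mem_bot_iff_pow_eq_self F p).2 hep
    have h2 : (⊥ : Subfield F) ≤
        RingHom.eqLocusField (MulSemiringAction.toRingHom G F σ) (RingHom.id F) := bot_le
    exact h2 h1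
  have hσe' : ∀ i : ℕ, σ ^ i • e = e := fun i =>
    (pow_mem (show σ ∈ MulAction.stabilizer G e from hσe) i : _)
  have h1 : ∑ i ∈ Finset.range p, σ ^ i • e = 0 := by
    simp_rw [hσe']
    simp
  have h2 : ∑ i ∈ Finset.range p, σ ^ i • (σ • b - b) = 0 := by
    simp_rw [smul_sub, smul_smul, ← pow_succ]
    rw [Finset.sum_range_sub (fun i => σ ^ i • b), hfix, pow_zero, one_smul, sub_self]
  rw [he] at h1
  simp_rw [smul_sub _ (σ • b - b)] at h1
  rw [Finset.sum_sub_distrib, h2, hQ1] at h1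
  simp at h1

end FieldAction

/-! ### Pro-`p` subgroups of the absolute Galois group -/

section Galois

open Polynomial

variable {k ks : Type*} [Field k] [Field ks] [Algebra k ks]

/-- For `ζ ≠ 1` the orbit has `p`-power size but at most `p - 1` elements. -/
theorem IsProP.smul_eq_of_pow_eq_one [Algebra.IsIntegral k ks] {p : ℕ} (hp : p.Prime)
    {P : Subgroup Gal(ks/k)} (hP : IsProP p P) {ζ : ks} (hζ : ζ ^ p = 1) (g : P) : g • ζ = ζ := by
  by_cases h1 : ζ = 1
  · rw [h1, smul_one]
  have hroot : ∀ g : P, (∑ i ∈ Finset.range p, X ^ i : ks[X]).IsRoot (g • ζ) := fun g => by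
    have h2 : g • ζ ≠ 1 := fun h => h1 (by rw [← smul_one g] at h; exact smul_left_cancel g h)
    have h3 := mul_geom_sum (g • ζ) p
    rw [← smul_pow', hζ, smul_one, sub_self] at h3
    simpa [eval_finsetSum, IsRoot.def] using (mul_eq_zero.1 h3).resolve_left (sub_ne_zero.2 h2)
  have hq : (∑ i ∈ Finset.range p, X ^ i : ks[X]) ≠ 0 := (monic_geom_sum_X hp.ne_zero).ne_zero
  obtain ⟨n, hn, hle⟩ := hP.index_stabilizer_eq_pow_le hp (a := ζ)
    ((stabilizer_isOpen_of_isIntegral ζ).preimage continuous_subtype_val) hq hroot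
  have hdeg : (∑ i ∈ Finset.range p, X ^ i : ks[X]).natDegree ≤ p - 1 :=
    natDegree_sum_le_of_forall_le _ _ fun i hi => by
      rw [natDegree_X_pow]
      have := Finset.mem_range.1 hi
      omega
  have hn0 : n = 0 := by
    by_contra h
    have := Nat.le_self_pow h p
    have := hp.pos
    omega
  rw [hn0, pow_zero, Subgroup.index_eq_one] at hn
  have : g ∈ MulAction.stabilizer P ζ := hn ▸ Subgroup.mem_top g
  exact this

theorem IsProP.smul_eq_of_mem_topFrattini [Algebra.IsIntegral k ks] {p : ℕ} (hp : p.Prime)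
    {P : Subgroup Gal(ks/k)} (hP : IsProP p P) {K : Subgroup P} (hK : IsClosed (K : Set P))
    {a : ks} {q : ks[X]} (hq : q ≠ 0) (hdeg : q.natDegree ≤ p)
    (hroot : ∀ g ∈ K, q.IsRoot (g • a)) {g : P} (hg : g ∈ K.topFrattini) : g • a = a := by
  have ho : IsOpen (MulAction.stabilizer K a : Set K) :=
    (stabilizer_isOpen_of_isIntegral a).preimage
      (continuous_subtype_val.comp continuous_subtype_val)
  have hKp := hP.of_isClosed hp K hK
  obtain ⟨n, hn, hle⟩ := hKp.index_stabilizer_eq_pow_le hp ho hq fun g => hroot g g.2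
  have hn1 : n ≤ 1 := by
    rw [← Nat.pow_le_pow_iff_right hp.one_lt, pow_one]
    exact hle.trans hdeg
  have := hKp.isTopologicalGroup
  have h := topFrattini_le_of_index_dvd hp (M := MulAction.stabilizer K a)
    (⟨_, ho⟩ : OpenSubgroup K).isClosed (by rw [hn]; simpa using pow_dvd_pow p hn1)
  obtain ⟨y, hy, rfl⟩ := hg
  exact h hy

theorem IsProP.mem_of_pow_mem_topFrattini [IsSepClosure k ks] {p : ℕ} (hp : p.Prime)
    (h2 : p = 2 → ∃ i : k, i ^ 2 = -1) {P : Subgroup Gal(ks/k)} (hP : IsProP p P)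
    {K : Subgroup P} (hK : IsClosed (K : Set P)) {x : P} (hx : x ^ p ∈ K.topFrattini) : x ∈ K := by
  have : IsSepClosed ks := IsSepClosure.sep_closed k
  have : IsGalois k ks := inferInstance
  by_contra hxK
  obtain ⟨M, hMc, hKM, hxM, hxpM, hconj⟩ := hP.exists_isClosed_pow_mem_notMem hp hK hxK
  have := hP.compactSpace
  have hMc' : IsClosed ((M.map P.subtype : Subgroup Gal(ks/k)) : Set Gal(ks/k)) :=
    (hMc.isCompact.image continuous_subtype_val).isClosed
  set N : Subfield ks := (IntermediateField.fixedField (M.map P.subtype)).toSubfield with hN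
  have hmemN : ∀ a, a ∈ N ↔ ∀ m ∈ M, m • a = a := fun a => by
    refine ⟨fun h m hm => h ⟨_, m, hm, rfl⟩, ?_⟩
    rintro h ⟨_, m, hm, rfl⟩
    exact h m hm
  have hσp : ∀ a ∈ N, x ^ p • a = a := fun a ha => (hmemN a).1 ha _ hxpM
  have hσN : ∀ a ∈ N, x • a ∈ N := fun a ha => (hmemN _).2 fun m hm => by
    have := (hmemN a).1 ha _ (hconj m hm)
    rw [mul_smul, mul_smul, inv_smul_eq_iff] at this
    exact this
  have hσ : ∃ a ∈ N, x • a ≠ a := by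
    by_contra! h
    have h1 := InfiniteGalois.fixingSubgroup_fixedField
      (⟨M.map P.subtype, hMc'⟩ : ClosedSubgroup Gal(ks/k))
    have h3 : (x : Gal(ks/k)) ∈ M.map P.subtype := by
      change _ = M.map P.subtype at h1
      rw [← h1, IntermediateField.mem_fixingSubgroup_iff]
      exact fun a ha => h a ha
    obtain ⟨y, hy, hyx⟩ := h3
    exact hxM (Subtype.ext hyx ▸ hy)
  by_cases hpF : (p : ks) = 0
  · have : CharP ks p := ringChar.of_eq
      (((Nat.dvd_prime hp).1 (ringChar.dvd hpF)).resolve_left CharP.ringChar_ne_one)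
    obtain ⟨b, c, hc, hbc, hne⟩ := exists_root_pow_smul_ne_of_charP hp hσp hσN hσ
    have hdeg : (X ^ p - X - C c : ks[X]).natDegree = p := by
      rw [natDegree_sub_C]
      exact FiniteField.X_pow_card_sub_X_natDegree_eq ks hp.one_lt
    refine hne (hP.smul_eq_of_mem_topFrattini hp hK (q := X ^ p - X - C c)
      (ne_zero_of_natDegree_gt (hdeg.symm ▸ hp.pos)) hdeg.le (fun g hg => ?_) hx)
    have hgc := (hmemN c).1 hc g (hKM hg)
    rw [← hbc, smul_sub, smul_pow', hbc] at hgc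
    simp [IsRoot.def, hgc]
  · have : NeZero (p : ks) := ⟨hpF⟩
    obtain ⟨ζ, hζ⟩ := HasEnoughRootsOfUnity.exists_primitiveRoot ks p
    have hfix := hP.smul_eq_of_pow_eq_one hp hζ.pow_eq_one
    obtain ⟨b, c, hc, hbc, hne⟩ := exists_root_pow_smul_ne_of_isPrimitiveRoot hp hpF hσp hσN hσ hζ
      ((hmemN ζ).2 fun m _ => hfix m) (hfix x) fun h => by
        obtain ⟨i, hi⟩ := h2 h
        exact ⟨algebraMap k ks i, by rw [← map_pow, hi, map_neg, map_one],
          (x : Gal(ks/k)).commutes i⟩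
    refine hne (hP.smul_eq_of_mem_topFrattini hp hK (q := X ^ p - C c)
      (X_pow_sub_C_ne_zero hp.pos c) natDegree_X_pow_sub_C.le (fun g hg => ?_) hx)
    have hgc := (hmemN c).1 hc g (hKM hg)
    rw [← hbc, smul_pow', hbc] at hgc
    simp [IsRoot.def, hgc]

theorem IsProP.stronglyFrattiniResistant [IsSepClosure k ks] {p : ℕ} (hp : p.Prime)
    (h2 : p = 2 → ∃ i : k, i ^ 2 = -1) {P : Subgroup Gal(ks/k)} (hP : IsProP p P) :
    StronglyFrattiniResistant P := fun H _ hH hK =>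
  ⟨hP.topFrattini_mono hp hK, fun h x hx => hP.mem_of_pow_mem_topFrattini hp h2 hK
    (h ⟨_, (hP.of_isClosed hp H hH).pow_mem_topFrattini hp ⟨x, hx⟩, rfl⟩)⟩

end Galois

theorem mainTheorem6 (k : Type*) [Field k] (ks : Type*) [Field ks] [Algebra k ks]
    [IsSepClosure k ks] :
    (∀ p : ℕ, p.Prime → Odd p →
      ∀ P : Subgroup Gal(ks/k), IsProP p P → StronglyFrattiniResistant P) ∧
    ((∃ i : k, i ^ 2 = -1) →
      ∀ P : Subgroup Gal(ks/k), IsProP 2 P → StronglyFrattiniResistant P) :=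
  ⟨fun p hp hodd _ hP => hP.stronglyFrattiniResistant hp fun h => by
      rw [h] at hodd
      exact absurd hodd (by decide),
    fun hi _ hP => hP.stronglyFrattiniResistant Nat.prime_two fun _ => hi⟩
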